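/- Let $q\ge 1$ and $n\ge 0$ be integers, write $[m]=\{1,\dots,m\}$, and for $p\ge 1$ let $$A_n^p=\frac{1}{pn+1}\binom{pn+1}{n}$$ be the Fuss-Catalan number. A set partition of $[m]$ is called planar (or non-crossing) if no two arcs of its standard diagram cross, where the arcs are the pairs $(i,j)$ with $i<j$ consecutive elements of a block, and two arcs $(i,j)$, $(k,l)$ cross if $i<k<j<l$. If $p=2q$, then $A_n^p$ is the number of pairs $(P_1,P_2)$ of planar partitions of $[qn]$ such that every block of $P_1$ has exactly $q$ elements and every block of $P_1$ is contained in a block of $P_2$. -/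

import Mathlib

namespace FussCatalan

/-- The set `[m] = {1, …, m}`. -/
abbrev interval (m : ℕ) : Finset ℕ := Finset.Icc 1 m

/-- The Fuss-Catalan number `A_n^p = (1 / (p n + 1)) * binom (p n + 1) n`, as a rational number. -/
def fussCatalan (p n : ℕ) : ℚ :=
  1 / ((p : ℚ) * n + 1) * ((p * n + 1).choose n : ℚ)

/-- `(i, j)` is an arc of the standard diagram of the set partition `P` of `[m]`:
`i < j` are consecutive elements of a block of `P`. -/
def IsArc {m : ℕ} (P : Finpartition (interval m)) (i j : ℕ) : Prop :=
  i < j ∧ ∃ B ∈ P.parts, i ∈ B ∧ j ∈ B ∧ ∀ k ∈ B, ¬ (i < k ∧ k < j)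

/-- A set partition of `[m]` is planar if no two arcs `(i, j)`, `(k, l)` of its standard diagram
(all of them drawn on the same side of the line of points) cross, i.e. satisfy
`i < k < j < l`. -/
def IsPlanar {m : ℕ} (P : Finpartition (interval m)) : Prop :=
  ∀ i j k l : ℕ, IsArc P i j → IsArc P k l → ¬ (i < k ∧ k < j ∧ j < l)

/-- Every block of the partition has exactly `q` elements. For `m = q * n` this says that `P` is
a `q`-partition of `[q n]`. -/
def IsQPartition {m : ℕ} (q : ℕ) (P : Finpartition (interval m)) : Prop :=
  ∀ B ∈ P.parts, B.card = q

/-- `P₁` is a refinement of `P₂`: each block of `P₁` is contained in a block of `P₂`. -/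
def IsRefinement {m : ℕ} (P₁ P₂ : Finpartition (interval m)) : Prop :=
  ∀ B ∈ P₁.parts, ∃ C ∈ P₂.parts, B ⊆ C

/-- The double planar partitions of `[m]`: pairs of planar partitions of which the first one is a
refinement of the second one. -/
def doublePlanarPartitions (m : ℕ) :
    Set (Finpartition (interval m) × Finpartition (interval m)) :=
  {D | IsPlanar D.1 ∧ IsPlanar D.2 ∧ IsRefinement D.1 D.2}

end FussCatalan

/-!
A planar partition of `{0, …, m - 1}` is the same as the map `f` sending an element to the minimum
of its block, and planarity becomes the condition that `f y ≤ x ≤ y` implies `f y ≤ f x`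
(`isPlanar_iff`). In this encoding, `f₁` refines `f₂` iff `f₂ ∘ f₁ = f₂`.

Let `F` be the generating function, by number of points, of the pairs to be counted, and let `H j`
be the one of the nonempty pairs in which the block of `0` in the finer partition has `j` elements
instead of `q`, the point `0` itself not being counted.

* If `0` is a singleton of the finer partition, then cutting at the next element of its block in the
  coarser partition leaves two arbitrary pairs, so `H 1 = F ^ 2` (`ncard_doubles_one`).
* Otherwise, cutting at the next element of its block in the finer partition gives
  `H (j + 1) = X * H 1 * H j` (`ncard_doubles_succ`).

Since `F = 1 + X * H q`, it follows that `F = 1 + X ^ q * F ^ (2 * q)` (`doubleSeries_eq`). This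
equation gives `F ^ (r + 1) = F ^ r + X ^ q * F ^ (r + 2 * q)`, a recurrence for the coefficients of
all powers of `F`. By Pascal's rule, the Raney numbers satisfy the same recurrence, and those for
`r = 1` are the Fuss-Catalan numbers (`coeff_pow_eq_raney`, `raney_one`).
-/

namespace FussCatalan

open Finset

/-! ### Powers of a solution of `F = 1 + X ^ q * F ^ p` -/

section Raney

open PowerSeries

/-- The Raney number `r / (p n + r) * binom (p n + r) n`, written without a denominator, so that
its value at `n = r = 0` is `1` rather than the junk value of `0 / 0`. -/
def raney (p r : ℕ) : ℕ → ℚ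
  | 0 => 1
  | n + 1 => ((p * (n + 1) + r).choose (n + 1) : ℚ) - p * ((p * (n + 1) + r - 1).choose n : ℚ)

theorem raney_zero_succ (p n : ℕ) : raney p 0 (n + 1) = 0 := by
  rcases Nat.eq_zero_or_pos p with rfl | hp
  · simp [raney]
  obtain ⟨k, hk⟩ : ∃ k, p * (n + 1) = k + 1 := ⟨p * (n + 1) - 1, by
    have : 0 < p * (n + 1) := by positivity
    omega⟩
  have h := Nat.add_one_mul_choose_eq k n
  rw [← hk] at h
  have h' : (p : ℚ) * (n + 1) * k.choose n = (p * (n + 1)).choose (n + 1) * (n + 1) := by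
    exact_mod_cast h
  have hn : (n : ℚ) + 1 ≠ 0 := by positivity
  have hk' : p * (n + 1) - 1 = k := by omega
  simp only [raney, add_zero, hk']
  apply mul_right_cancel₀ hn
  linear_combination -h'

/-- The Pascal recurrence of the Raney numbers. -/
theorem raney_succ_succ {p : ℕ} (hp : 0 < p) (r n : ℕ) :
    raney p (r + 1) (n + 1) = raney p r (n + 1) + raney p (r + p) n := by
  obtain ⟨N, hN⟩ : ∃ N, p * (n + 1) + r = N + 1 := ⟨p * (n + 1) + r - 1, by
    have : 0 < p * (n + 1) := by positivity
    omega⟩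
  have h1 : p * (n + 1) + (r + 1) = N + 2 := by omega
  cases n with
  | zero =>
    simp only [raney, hN, h1]
    simp
    ring
  | succ n =>
    have h2 : p * (n + 1) + (r + p) = N + 1 := by rw [← hN]; ring
    simp only [raney, hN, h1, h2]
    rw [show N + 2 - 1 = N + 1 by omega, show N + 1 - 1 = N by omega,
      Nat.choose_succ_succ (N + 1) (n + 1), Nat.choose_succ_succ N n]
    push_cast
    ring

theorem raney_one (p n : ℕ) : raney p 1 n = fussCatalan p n := by
  cases n with
  | zero => simp [raney, fussCatalan]
  | succ n =>
    have h := Nat.add_one_mul_choose_eq (p * (n + 1)) n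
    have h' : ((p : ℚ) * (n + 1) + 1) * (p * (n + 1)).choose n =
        (p * (n + 1) + 1).choose (n + 1) * (n + 1) := by exact_mod_cast h
    have hd : (p : ℚ) * (n + 1) + 1 ≠ 0 := by positivity
    simp only [raney, fussCatalan, Nat.add_sub_cancel]
    push_cast
    field_simp
    linear_combination -(p : ℚ) * h'

/-- The functional equation `F = 1 + X ^ q * F ^ p` determines the coefficients of all powers of
`F`: it gives `F ^ (r + 1) = F ^ r + X ^ q * F ^ (r + p)`, which is the recurrence of the
Raney numbers. -/
theorem coeff_pow_eq_raney {p q : ℕ} (hp : 0 < p) (hq : 0 < q) {F : PowerSeries ℚ}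
    (hF : F = 1 + X ^ q * F ^ p) (n r : ℕ) : coeff (q * n) (F ^ r) = raney p r n := by
  induction n generalizing r with
  | zero =>
    have h0 : constantCoeff F = 1 := by
      rw [hF]
      simp [hq.ne']
    simp [raney, h0]
  | succ n ihn =>
    induction r with
    | zero =>
      rw [raney_zero_succ, pow_zero, coeff_one, if_neg (by positivity)]
    | succ r ihr =>
      have hpow : F ^ (r + 1) = F ^ r + X ^ q * F ^ (r + p) := by
        rw [pow_succ]
        nth_rewrite 2 [hF]
        ring
      rw [hpow, map_add, ihr, coeff_X_pow_mul', if_pos (by nlinarith),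
        show q * (n + 1) - q = q * n by rw [mul_add]; omega, ihn, raney_succ_succ hp]

end Raney

/-! ### Planar partitions as maps -/

/-- The encoding of a planar partition of `{0, …, m - 1}` by the map `f` sending each element to
the minimum of its block, extended by the identity beyond `m`. Idempotence of `f` follows from
`le_self` and `le_of_le`, see `IsPlanarMap.idem`. -/
structure IsPlanarMap (m : ℕ) (f : ℕ → ℕ) : Prop where
  le_self : ∀ x, f x ≤ x
  le_of_le : ∀ x y, f y ≤ x → x ≤ y → f y ≤ f x
  eq_self : ∀ x, m ≤ x → f x = x

namespace IsPlanarMap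

variable {m a b : ℕ} {f g h : ℕ → ℕ}

theorem zero (hf : IsPlanarMap m f) : f 0 = 0 := Nat.le_zero.1 (hf.le_self 0)

theorem idem (hf : IsPlanarMap m f) (x : ℕ) : f (f x) = f x :=
  (hf.le_self _).antisymm (hf.le_of_le _ _ le_rfl (hf.le_self x))

theorem id (m : ℕ) : IsPlanarMap m id :=
  ⟨fun _ => le_rfl, fun _ _ h _ => h, fun _ _ => rfl⟩

theorem lt_iff (hf : IsPlanarMap m f) (x : ℕ) : f x < m ↔ x < m := by
  have := hf.le_self x
  have := hf.eq_self x
  omega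

end IsPlanarMap

theorem finite_setOf_isPlanarMap (m : ℕ) : {f | IsPlanarMap m f}.Finite := by
  let φ : {f | IsPlanarMap m f} → (Fin m → Fin m) := fun f i =>
    ⟨f.1 i, (f.2.le_self i).trans_lt i.2⟩
  have hφ : Function.Injective φ := by
    rintro ⟨f, hf⟩ ⟨g, hg⟩ hfg
    ext x
    rcases lt_or_ge x m with hx | hx
    · exact congrArg Fin.val (congrFun hfg ⟨x, hx⟩)
    · exact (hf.eq_self x hx).trans (hg.eq_self x hx).symm
  exact Finite.of_injective φ hφ

/-- The partition that is `g` on `[0, a)` and, shifted by `a`, `h` on the rest. -/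
def append (a : ℕ) (g h : ℕ → ℕ) (y : ℕ) : ℕ :=
  if y < a then g y else h (y - a) + a

/-- The partition obtained from `append a g h` by merging the block of `a` into the block of `0`,
where `h` encodes a partition of `{0, …, b - 1}`. For `b = 0` there is nothing to merge, and the
bound `y < a + b` keeps the map equal to the identity outside of the ground set. -/
def attach (a b : ℕ) (g h : ℕ → ℕ) (y : ℕ) : ℕ :=
  if y < a then g y else if h (y - a) = 0 ∧ y < a + b then 0 else h (y - a) + a

/-- The restriction of a partition to `[0, a)`. -/
def restrict (a : ℕ) (f : ℕ → ℕ) (y : ℕ) : ℕ := if y < a then f y else y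

/-- The restriction of a partition to `[a, ∞)`, shifted down by `a`. The truncated subtraction
sends to `0` every element whose block reaches below `a`, so that all these blocks become one
block with minimum `0`. Hence `drop a` undoes `append a` as well as `attach a b`. -/
def drop (a : ℕ) (f : ℕ → ℕ) (y : ℕ) : ℕ := f (y + a) - a

section Maps

variable {m a b : ℕ} {f f₁ f₂ g g₁ g₂ h h₁ h₂ : ℕ → ℕ}

theorem IsPlanarMap.append (hg : IsPlanarMap a g) (hh : IsPlanarMap b h) :
    IsPlanarMap (a + b) (append a g h) where
  le_self x := by
    have := hg.le_self x
    have := hh.le_self (x - a)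
    unfold FussCatalan.append
    split_ifs <;> omega
  le_of_le x y h1 h2 := by
    have := hg.le_self x
    have := hg.le_of_le x y
    have := hh.le_of_le (x - a) (y - a)
    unfold FussCatalan.append at *
    split_ifs at * <;> omega
  eq_self x hx := by
    have := hh.eq_self (x - a)
    unfold FussCatalan.append
    split_ifs <;> omega

theorem IsPlanarMap.attach (ha : 0 < a) (hg : IsPlanarMap a g) (hh : IsPlanarMap b h) :
    IsPlanarMap (a + b) (attach a b g h) where
  le_self x := by
    have := hg.le_self x
    have := hh.le_self (x - a)
    unfold FussCatalan.attach
    split_ifs <;> omega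
  le_of_le x y h1 h2 := by
    have := hg.le_self x
    have := hg.le_of_le x y
    have := hh.le_of_le (x - a) (y - a)
    have := hh.eq_self (y - a)
    unfold FussCatalan.attach at *
    split_ifs at * <;> omega
  eq_self x hx := by
    have := hh.eq_self (x - a)
    unfold FussCatalan.attach
    split_ifs <;> omega

theorem IsPlanarMap.restrict (hf : IsPlanarMap m f) (a : ℕ) :
    IsPlanarMap a (restrict a f) where
  le_self x := by
    have := hf.le_self x
    unfold FussCatalan.restrict
    split_ifs <;> omega
  le_of_le x y h1 h2 := by
    have := hf.le_of_le x y
    unfold FussCatalan.restrict at *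
    split_ifs at * <;> omega
  eq_self x hx := by
    unfold FussCatalan.restrict
    split_ifs <;> omega

theorem IsPlanarMap.drop (hf : IsPlanarMap (a + b) f) : IsPlanarMap b (drop a f) where
  le_self x := by
    have := hf.le_self (x + a)
    unfold FussCatalan.drop
    omega
  le_of_le x y h1 h2 := by
    have := hf.le_of_le (x + a) (y + a)
    unfold FussCatalan.drop at *
    omega
  eq_self x hx := by
    have := hf.eq_self (x + a)
    unfold FussCatalan.drop
    omega

theorem restrict_append (hg : IsPlanarMap a g) : restrict a (append a g h) = g := by
  ext y
  have := hg.eq_self y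
  unfold restrict append
  split_ifs <;> omega

theorem drop_append : drop a (append a g h) = h := by
  ext y
  simp [drop, append]

theorem restrict_attach (hg : IsPlanarMap a g) : restrict a (attach a b g h) = g := by
  ext y
  have := hg.eq_self y
  unfold restrict attach
  split_ifs <;> omega

theorem drop_attach : drop a (attach a b g h) = h := by
  ext y
  simp only [drop, attach, Nat.add_sub_cancel]
  split_ifs <;> omega

theorem append_restrict_drop (hf : ∀ y, a ≤ y → a ≤ f y) :
    append a (restrict a f) (drop a f) = f := by
  ext y
  simp only [append, restrict, drop]
  split_ifs with h1
  · rfl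
  · rw [Nat.sub_add_cancel (not_lt.1 h1), Nat.sub_add_cancel (hf y (not_lt.1 h1))]

theorem attach_restrict_drop (hf : IsPlanarMap (a + b) f) (h0 : b = 0 ∨ f a = 0) :
    attach a b (restrict a f) (drop a f) = f := by
  ext y
  have h1 := hf.le_of_le a y
  have h2 := hf.eq_self y
  simp only [attach, restrict, drop]
  by_cases h3 : y < a
  · simp only [h3, if_true]
  · simp only [h3, if_false, Nat.sub_add_cancel (not_lt.1 h3)]
    split_ifs <;> omega

/-! ### Refinements -/

/-- `f₁` refines `f₂`, for partitions encoded by the minima of their blocks. -/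
def Refines (f₁ f₂ : ℕ → ℕ) : Prop := ∀ x, f₂ (f₁ x) = f₂ x

theorem Refines.append (hg : Refines g₁ g₂) (hh : Refines h₁ h₂) (h1 : IsPlanarMap a g₁) :
    Refines (append a g₁ h₁) (append a g₂ h₂) := by
  intro x
  have := hg x
  have := h1.le_self x
  have := hh (x - a)
  simp only [FussCatalan.append]
  split_ifs <;> first | omega | simp_all

theorem Refines.append_attach (hg : Refines g₁ g₂) (hh : Refines h₁ h₂) (h1 : IsPlanarMap a g₁)
    (h2 : IsPlanarMap b h₁) : Refines (FussCatalan.append a g₁ h₁) (attach a b g₂ h₂) := by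
  intro x
  have := hg x
  have := h1.le_self x
  have e1 := hh (x - a)
  have := h2.lt_iff (x - a)
  simp only [FussCatalan.append, attach]
  by_cases hx : x < a
  · simp only [hx, if_true]
    rw [if_pos (by omega)]
    exact hg x
  · simp only [hx, if_false]
    rw [if_neg (by omega), Nat.add_sub_cancel, e1]
    have : h₁ (x - a) + a < a + b ↔ x < a + b := by omega
    simp only [this]

theorem Refines.attach (ha : 0 < a) (hg : Refines g₁ g₂) (hh : Refines h₁ h₂)
    (h1 : IsPlanarMap a g₁) (h2 : IsPlanarMap b h₁) (h3 : g₂ 0 = 0) (h4 : h₂ 0 = 0) :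
    Refines (attach a b g₁ h₁) (FussCatalan.attach a b g₂ h₂) := by
  intro x
  by_cases h0 : a ≤ x ∧ h₁ (x - a) = 0 ∧ x < a + b
  · have e : h₂ (x - a) = 0 := by rw [← hh, h0.2.1, h4]
    simp [FussCatalan.attach, h0, e, ha, h3, not_lt.2 h0.1]
  · have e : FussCatalan.attach a b g₁ h₁ x = FussCatalan.append a g₁ h₁ x := by
      unfold FussCatalan.append FussCatalan.attach
      split_ifs <;> omega
    rw [e]
    exact hg.append_attach hh h1 h2 x

theorem Refines.restrict (hr : Refines f₁ f₂) (h1 : ∀ x, f₁ x ≤ x) (a : ℕ) :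
    Refines (restrict a f₁) (restrict a f₂) := by
  intro x
  have := hr x
  have := h1 x
  simp only [FussCatalan.restrict]
  split_ifs <;> omega

theorem Refines.drop (hr : Refines f₁ f₂) (h2 : ∀ x, f₂ x ≤ x) (a : ℕ) :
    Refines (drop a f₁) (drop a f₂) := by
  intro x
  have e := hr (x + a)
  have := h2 (f₁ (x + a))
  have := h2 a
  simp only [FussCatalan.drop]
  rcases le_total a (f₁ (x + a)) with h | h
  · rw [Nat.sub_add_cancel h, e]
  · rw [Nat.sub_eq_zero_of_le h, zero_add]
    omega

/-! ### Block sizes -/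

/-- The number of elements below `m` of the block with minimum `v`. -/
def blockCard (m : ℕ) (f : ℕ → ℕ) (v : ℕ) : ℕ := Nat.count (fun y => f y = v) m

theorem blockCard_append_of_lt (g h) {v : ℕ} (hv : v < a) :
    blockCard (a + b) (append a g h) v = blockCard a g v := by
  unfold blockCard
  have h0 : Nat.count (fun k => append a g h (a + k) = v) b = 0 := by
    rw [Nat.count_iff_forall_not]
    intro x _
    simp only [append]
    split_ifs <;> omega
  rw [Nat.count_add, h0, add_zero]
  simp only [Nat.count_eq_card_filter_range]
  congr 1
  apply Finset.filter_congr
  intro x hx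
  simp [append, Finset.mem_range.1 hx]

theorem blockCard_append_add (hg : IsPlanarMap a g) (v : ℕ) :
    blockCard (a + b) (append a g h) (a + v) = blockCard b h v := by
  unfold blockCard
  have h0 : Nat.count (fun y => append a g h y = a + v) a = 0 := by
    rw [Nat.count_iff_forall_not]
    intro x hx
    have := hg.le_self x
    rw [append, if_pos hx]
    omega
  rw [Nat.count_add, h0, zero_add]
  simp only [Nat.count_eq_card_filter_range]
  congr 1
  apply Finset.filter_congr
  intro x _
  simp [append, add_comm]

theorem blockCard_attach_of_lt (g h) {v : ℕ} (hv : v < a) (h0 : v ≠ 0) :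
    blockCard (a + b) (attach a b g h) v = blockCard a g v := by
  rw [← blockCard_append_of_lt (b := b) g h hv]
  unfold blockCard
  congr 1
  ext x
  unfold append attach
  split_ifs <;> omega

theorem blockCard_attach_zero :
    blockCard (a + b) (attach a b g h) 0 = blockCard a g 0 + blockCard b h 0 := by
  unfold blockCard
  rw [Nat.count_add]
  congr 1
  · simp only [Nat.count_eq_card_filter_range]
    congr 1
    apply Finset.filter_congr
    intro x hx
    simp [attach, Finset.mem_range.1 hx]
  · simp only [Nat.count_eq_card_filter_range]
    congr 1
    apply Finset.filter_congr
    intro x hx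
    have := Finset.mem_range.1 hx
    simp only [attach]
    rw [if_neg (by omega), Nat.add_sub_cancel_left]
    split_ifs <;> omega

theorem blockCard_attach_add (hg : IsPlanarMap a g) {v : ℕ} (hv : v ≠ 0) :
    blockCard (a + b) (attach a b g h) (a + v) = blockCard b h v := by
  rw [← blockCard_append_add (b := b) (h := h) hg]
  unfold blockCard
  congr 1
  ext x
  unfold append attach
  split_ifs <;> omega

end Maps

/-! ### Decompositions of double planar partitions -/

/-- The encoding of a double planar partition `(P₁, P₂)` of `{0, …, m - 1}` by planar maps, where
all blocks of `P₁` have `q` elements except for the block of `0`, which has `j` elements. -/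
structure IsDouble (q j m : ℕ) (F : (ℕ → ℕ) × (ℕ → ℕ)) : Prop where
  planar_fst : IsPlanarMap m F.1
  planar_snd : IsPlanarMap m F.2
  refines : Refines F.1 F.2
  blockCard_eq : ∀ v < m, F.1 v = v → blockCard m F.1 v = if v = 0 then j else q

/-- The set of pairs of maps satisfying `IsDouble q j m`. -/
def doubles (q j m : ℕ) : Set ((ℕ → ℕ) × (ℕ → ℕ)) := {F | IsDouble q j m F}

theorem finite_doubles (q j m : ℕ) : (doubles q j m).Finite :=
  ((finite_setOf_isPlanarMap m).prod (finite_setOf_isPlanarMap m)).subset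
    fun _ hF => ⟨hF.planar_fst, hF.planar_snd⟩

theorem one_lt_blockCard {m y : ℕ} {f : ℕ → ℕ} (hf : IsPlanarMap m f) (hm : 0 < m) (hy : y ≠ 0)
    (h : f y = 0) : 1 < blockCard m f 0 := by
  rw [blockCard, Nat.count_eq_card_filter_range, Finset.one_lt_card]
  have := hf.eq_self y
  exact ⟨0, by simp [hm, hf.zero], y, by simp [h]; omega, hy.symm⟩

theorem IsDouble.blockCard_zero {q j m : ℕ} {F : (ℕ → ℕ) × (ℕ → ℕ)} (hF : IsDouble q j m F)
    (hm : 0 < m) : blockCard m F.1 0 = j := by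
  simpa using hF.blockCard_eq 0 hm hF.planar_fst.zero

theorem IsDouble.ne_zero {q m y : ℕ} {F : (ℕ → ℕ) × (ℕ → ℕ)} (hF : IsDouble q 1 m F)
    (hm : 0 < m) (hy : y ≠ 0) : F.1 y ≠ 0 := fun h => by
  have := one_lt_blockCard hF.planar_fst hm hy h
  rw [hF.blockCard_zero hm] at this
  omega

/-- Counting a set whose elements decompose uniquely into two pieces of total size `m`. -/
theorem ncard_eq_sum_antidiagonal {α β γ : Type*} {S : ℕ → Set α} {T : ℕ → Set β} {U : Set γ}
    {m : ℕ} (glue : ℕ → ℕ → α → β → γ) (hS : ∀ a, (S a).Finite) (hT : ∀ b, (T b).Finite)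
    (hmaps : ∀ a b, a + b = m → ∀ s ∈ S a, ∀ t ∈ T b, glue a b s t ∈ U)
    (hindex : ∀ a b, a + b = m → ∀ s ∈ S a, ∀ t ∈ T b,
      ∀ a' b', a' + b' = m → ∀ s' ∈ S a', ∀ t' ∈ T b',
      glue a b s t = glue a' b' s' t' → ¬ a < a')
    (hinj : ∀ a b, a + b = m → ∀ s ∈ S a, ∀ t ∈ T b, ∀ s' ∈ S a, ∀ t' ∈ T b,
      glue a b s t = glue a b s' t' → s = s' ∧ t = t')
    (hsurj : ∀ u ∈ U, ∃ a b, a + b = m ∧ ∃ s ∈ S a, ∃ t ∈ T b, glue a b s t = u) :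
    U.ncard = ∑ p ∈ antidiagonal m, (S p.1).ncard * (T p.2).ncard := by
  classical
  let A : Finset (Σ _ : ℕ × ℕ, α × β) :=
    (antidiagonal m).sigma fun p => (hS p.1).toFinset ×ˢ (hT p.2).toFinset
  have hA : #A = ∑ p ∈ antidiagonal m, (S p.1).ncard * (T p.2).ncard := by
    rw [Finset.card_sigma]
    refine Finset.sum_congr rfl fun p _ => ?_
    rw [Finset.card_product, Set.ncard_eq_toFinset_card _ (hS p.1),
      Set.ncard_eq_toFinset_card _ (hT p.2)]
  have hU : U = (fun x : Σ _ : ℕ × ℕ, α × β => glue x.1.1 x.1.2 x.2.1 x.2.2) '' (A : Set _) := by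
    ext u
    constructor
    · intro hu
      obtain ⟨a, b, hab, s, hs, t, ht, rfl⟩ := hsurj u hu
      exact ⟨⟨(a, b), (s, t)⟩, by simp [A, hab, hs, ht], rfl⟩
    · rintro ⟨⟨⟨a, b⟩, ⟨s, t⟩⟩, hx, rfl⟩
      simp only [A, Finset.coe_sigma, Set.mem_sigma_iff, Finset.mem_coe,
        HasAntidiagonal.mem_antidiagonal, Finset.mem_product, Set.Finite.mem_toFinset] at hx
      exact hmaps a b hx.1 s hx.2.1 t hx.2.2
  rw [← hA, hU, Set.InjOn.ncard_image, Set.ncard_coe_finset]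
  rintro ⟨⟨a, b⟩, ⟨s, t⟩⟩ hx ⟨⟨a', b'⟩, ⟨s', t'⟩⟩ hx' h
  simp only [A, Finset.coe_sigma, Set.mem_sigma_iff, Finset.mem_coe,
    HasAntidiagonal.mem_antidiagonal, Finset.mem_product, Set.Finite.mem_toFinset] at hx hx'
  obtain ⟨hab, hs, ht⟩ := hx
  obtain ⟨hab', hs', ht'⟩ := hx'
  have h1 := hindex a b hab s hs t ht a' b' hab' s' hs' t' ht' h
  have h2 := hindex a' b' hab' s' hs' t' ht' a b hab s hs t ht h.symm
  obtain rfl : a = a' := by omega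
  obtain rfl : b = b' := by omega
  obtain ⟨rfl, rfl⟩ := hinj a b hab s hs t ht s' hs' t' ht' h
  rfl

/-- Double planar partitions in which `0` is a singleton of the finer partition. The first piece
lives strictly between `0` and the next element `c` of its block in the coarser partition, the
second piece starts at `c`; if there is no such `c`, then the second piece is empty. -/
theorem ncard_doubles_one (q m : ℕ) :
    (doubles q 1 (1 + m)).ncard =
      ∑ p ∈ antidiagonal m, (doubles q q p.1).ncard * (doubles q q p.2).ncard := by
  refine ncard_eq_sum_antidiagonal
    (fun a b G H => (append (1 + a) (append 1 id G.1) H.1,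
      attach (1 + a) b (append 1 id G.2) H.2))
    (finite_doubles q q) (finite_doubles q q) ?_ ?_ ?_ ?_
  · rintro a b rfl ⟨g₁, g₂⟩ hG ⟨h₁, h₂⟩ hH
    have hg₁ := (IsPlanarMap.id 1).append hG.planar_fst
    have hg₂ := (IsPlanarMap.id 1).append hG.planar_snd
    refine ⟨?_, ?_, ?_, ?_⟩
    · simpa only [add_assoc] using hg₁.append hH.planar_fst
    · simpa only [add_assoc] using hg₂.attach (by omega) hH.planar_snd
    · have hid : Refines id id := fun _ => rfl
      exact (hid.append hG.refines (IsPlanarMap.id 1)).append_attach hH.refines hg₁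
        hH.planar_fst
    · intro v hv hfix
      dsimp only at *
      rw [← add_assoc]
      rcases lt_or_ge v (1 + a) with h | h
      · rw [blockCard_append_of_lt _ _ h]
        rw [append, if_pos h] at hfix
        rcases Nat.eq_zero_or_pos v with rfl | h0
        · rw [blockCard_append_of_lt _ _ one_pos]
          simp [blockCard, Nat.count_one]
        · obtain ⟨u, rfl⟩ := Nat.exists_eq_add_of_le (Nat.succ_le_of_lt h0)
          have := hG.blockCard_eq u (by omega) (by simp [append] at hfix ⊢; omega)
          rw [Nat.succ_eq_add_one, zero_add, blockCard_append_add (IsPlanarMap.id 1), this]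
          simp
      · obtain ⟨u, rfl⟩ := Nat.exists_eq_add_of_le h
        have := hH.blockCard_eq u (by omega) (by simp [append] at hfix ⊢; omega)
        rw [blockCard_append_add hg₁, this]
        split_ifs <;> omega
  · rintro a b hab ⟨g₁, g₂⟩ hG ⟨h₁, h₂⟩ hH a' b' hab' ⟨g₁', g₂'⟩ hG' ⟨h₁', h₂'⟩ hH' h hlt
    -- the coarser glued map vanishes at `1 + a` but not strictly between `0` and `1 + a'`
    have h2 := congrFun (congrArg Prod.snd h) (1 + a)
    have h0 := hH.planar_snd.zero
    dsimp only at h2 h0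
    rw [attach, if_neg (by omega), if_pos ⟨by simpa using h0, by omega⟩, attach,
      if_pos (by omega), append, if_neg (by omega)] at h2
    omega
  · rintro a b hab ⟨g₁, g₂⟩ hG ⟨h₁, h₂⟩ hH ⟨g₁', g₂'⟩ hG' ⟨h₁', h₂'⟩ hH' h
    obtain ⟨e1, e2⟩ := Prod.mk.inj h
    have p1 := (IsPlanarMap.id 1).append hG.planar_fst
    have p2 := (IsPlanarMap.id 1).append hG.planar_snd
    have p1' := (IsPlanarMap.id 1).append hG'.planar_fst
    have p2' := (IsPlanarMap.id 1).append hG'.planar_snd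
    have r1 := congrArg (restrict (1 + a)) e1
    have r2 := congrArg (restrict (1 + a)) e2
    have d1 := congrArg (drop (1 + a)) e1
    have d2 := congrArg (drop (1 + a)) e2
    dsimp only at *
    rw [restrict_append p1, restrict_append p1'] at r1
    rw [restrict_attach p2, restrict_attach p2'] at r2
    rw [drop_append, drop_append] at d1
    rw [drop_attach, drop_attach] at d2
    have r1 := congrArg (drop 1) r1
    have r2 := congrArg (drop 1) r2
    rw [drop_append, drop_append] at r1 r2
    simp [r1, r2, d1, d2]
  · rintro ⟨f₁, f₂⟩ hF
    obtain ⟨a, b, rfl, h0, hmin⟩ : ∃ a b, a + b = m ∧ (b = 0 ∨ f₂ (1 + a) = 0) ∧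
        ∀ y, 1 ≤ y → y < 1 + a → f₂ y ≠ 0 := by
      have hex : ∃ y, 1 ≤ y ∧ (f₂ y = 0 ∨ y = 1 + m) := ⟨1 + m, by omega, Or.inr rfl⟩
      classical
      have h1 := Nat.find_spec hex
      have h2 : Nat.find hex ≤ 1 + m := Nat.find_min' hex ⟨by omega, Or.inr rfl⟩
      refine ⟨Nat.find hex - 1, 1 + m - Nat.find hex, by omega, ?_, ?_⟩
      · rw [Nat.add_sub_cancel' h1.1]
        rcases h1.2 with h | h
        · exact Or.inr h
        · left
          omega
      · intro y hy hlt h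
        exact Nat.find_min hex (m := y) (by omega) ⟨hy, Or.inl h⟩
    have hp₁ : IsPlanarMap (1 + a + b) f₁ := by simpa only [add_assoc] using hF.planar_fst
    have hp₂ : IsPlanarMap (1 + a + b) f₂ := by simpa only [add_assoc] using hF.planar_snd
    have hr : Refines f₁ f₂ := hF.refines
    have hpos : ∀ y, 1 ≤ y → 1 ≤ f₁ y := fun y hy =>
      Nat.one_le_iff_ne_zero.2 (hF.ne_zero (by omega) (by omega))
    -- blocks of `f₁` do not cross the cut: otherwise the minimum of such a block would lie in
    -- the `f₂`-block of `0`, contradicting the choice of the cut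
    have hcut : ∀ y, 1 + a ≤ y → 1 + a ≤ f₁ y := by
      intro y hy
      by_contra hlt
      have h1 := hpos y (by omega)
      have h2 := hp₂.le_self (f₁ y)
      have h3 := hr y
      have h4 := hp₂.le_of_le (1 + a) y
      have h5 := hp₁.eq_self y
      have h6 := hmin (f₁ y)
      omega
    have hcut₁ : ∀ y, 1 ≤ y → 1 ≤ restrict (1 + a) f₁ y := by
      intro y hy
      have := hpos y hy
      unfold restrict
      split_ifs <;> omega
    have hcut₂ : ∀ y, 1 ≤ y → 1 ≤ restrict (1 + a) f₂ y := by
      intro y hy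
      have := hmin y hy
      unfold restrict
      split_ifs <;> omega
    have hid : ∀ f, IsPlanarMap (1 + a) f → restrict 1 f = id := by
      intro f hf
      ext y
      have := hf.zero
      unfold restrict
      split_ifs with h
      · obtain rfl : y = 0 := by omega
        simpa using this
      · rfl
    have q₁ := hp₁.restrict (1 + a)
    have q₂ := hp₂.restrict (1 + a)
    have e₁' := append_restrict_drop hcut₁
    have e₂' := append_restrict_drop hcut₂
    rw [hid _ q₁] at e₁'
    rw [hid _ q₂] at e₂'
    have e₁ := append_restrict_drop hcut
    have e₂ := attach_restrict_drop hp₂ h0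
    refine ⟨a, b, rfl, (drop 1 (restrict (1 + a) f₁), drop 1 (restrict (1 + a) f₂)),
      ⟨q₁.drop, q₂.drop, (hr.restrict hp₁.le_self _).drop q₂.le_self _, ?_⟩,
      (drop (1 + a) f₁, drop (1 + a) f₂), ⟨hp₁.drop, hp₂.drop, hr.drop hp₂.le_self _, ?_⟩, ?_⟩
    · intro v hv hfix
      have := hF.blockCard_eq (1 + v) (by omega) (by
        have h1 := hpos (1 + v) (by omega)
        simp only [drop, restrict] at hfix
        rw [if_pos (by omega), add_comm v 1] at hfix
        dsimp only
        omega)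
      dsimp only at this ⊢
      rw [← add_assoc, ← e₁, blockCard_append_of_lt _ _ (by omega), ← e₁',
        blockCard_append_add (IsPlanarMap.id 1), if_neg (by omega)] at this
      rw [this]
      simp
    · intro v hv hfix
      have := hF.blockCard_eq (1 + a + v) (by omega) (by
        have h1 := hcut (1 + a + v) (by omega)
        simp only [drop] at hfix
        rw [add_comm v (1 + a)] at hfix
        dsimp only
        omega)
      dsimp only at this ⊢
      rw [← add_assoc, ← e₁, blockCard_append_add q₁, if_neg (by omega)] at this
      rw [this]
      simp
    · dsimp only
      rw [e₁', e₂', e₁, e₂]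

/-- Double planar partitions in which the block of `0` of the finer partition has a further
element: cutting at its second element `x` leaves a piece with `0` as a singleton, and a piece
whose block of `x` has one element less. -/
theorem ncard_doubles_succ (q j m : ℕ) (hj : 0 < j) :
    (doubles q (j + 1) (1 + (m + 1))).ncard =
      ∑ p ∈ antidiagonal m, (doubles q 1 (1 + p.1)).ncard * (doubles q j (1 + p.2)).ncard := by
  refine ncard_eq_sum_antidiagonal (S := fun a => doubles q 1 (1 + a))
    (T := fun b => doubles q j (1 + b))
    (fun a b G H => (attach (1 + a) (1 + b) G.1 H.1, attach (1 + a) (1 + b) G.2 H.2))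
    (fun _ => finite_doubles _ _ _) (fun _ => finite_doubles _ _ _) ?_ ?_ ?_ ?_
  · rintro a b rfl ⟨g₁, g₂⟩ hG ⟨h₁, h₂⟩ hH
    have hsum : 1 + (a + b + 1) = 1 + a + (1 + b) := by ring
    rw [hsum]
    refine ⟨hG.planar_fst.attach (by omega) hH.planar_fst,
      hG.planar_snd.attach (by omega) hH.planar_snd,
      hG.refines.attach (by omega) hH.refines hG.planar_fst hH.planar_fst hG.planar_snd.zero
        hH.planar_snd.zero, ?_⟩
    intro v hv hfix
    dsimp only at *
    rcases Nat.eq_zero_or_pos v with rfl | h0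
    · rw [blockCard_attach_zero, hG.blockCard_zero (by omega), hH.blockCard_zero (by omega)]
      simp [add_comm]
    rcases lt_or_ge v (1 + a) with h | h
    · rw [attach, if_pos h] at hfix
      rw [blockCard_attach_of_lt _ _ h (by omega), hG.blockCard_eq v h hfix,
        if_neg (by omega), if_neg (by omega)]
    · obtain ⟨u, rfl⟩ := Nat.exists_eq_add_of_le h
      have hz := hH.planar_fst.zero
      simp only [attach, Nat.add_sub_cancel_left] at hfix hz
      rw [if_neg (by omega)] at hfix
      have hu : h₁ u ≠ 0 ∧ h₁ u = u := by
        split_ifs at hfix <;> omega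
      have hu0 : u ≠ 0 := by omega
      rw [blockCard_attach_add hG.planar_fst hu0, hH.blockCard_eq u (by omega) hu.2,
        if_neg hu0, if_neg (by omega)]
  · rintro a b hab ⟨g₁, g₂⟩ hG ⟨h₁, h₂⟩ hH a' b' hab' ⟨g₁', g₂'⟩ hG' ⟨h₁', h₂'⟩ hH' h hlt
    have h2 := congrFun (congrArg Prod.fst h) (1 + a)
    have h0 := hH.planar_fst.zero
    dsimp only at h2 h0
    rw [attach, if_neg (by omega), if_pos ⟨by simpa using h0, by omega⟩, attach,
      if_pos (by omega)] at h2
    exact hG'.ne_zero (by omega) (by omega) h2.symm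
  · rintro a b hab ⟨g₁, g₂⟩ hG ⟨h₁, h₂⟩ hH ⟨g₁', g₂'⟩ hG' ⟨h₁', h₂'⟩ hH' h
    obtain ⟨e1, e2⟩ := Prod.mk.inj h
    have r1 := congrArg (restrict (1 + a)) e1
    have r2 := congrArg (restrict (1 + a)) e2
    have d1 := congrArg (drop (1 + a)) e1
    have d2 := congrArg (drop (1 + a)) e2
    rw [restrict_attach hG.planar_fst, restrict_attach hG'.planar_fst] at r1
    rw [restrict_attach hG.planar_snd, restrict_attach hG'.planar_snd] at r2
    rw [drop_attach, drop_attach] at d1 d2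
    dsimp only at *
    simp [r1, r2, d1, d2]
  · rintro ⟨f₁, f₂⟩ hF
    obtain ⟨a, b, rfl, h0, hmin⟩ : ∃ a b, a + b = m ∧ f₁ (1 + a) = 0 ∧
        ∀ y, 1 ≤ y → y < 1 + a → f₁ y ≠ 0 := by
      have hcard := hF.blockCard_zero (by omega)
      dsimp only at hcard
      obtain ⟨y, hy, hy0⟩ : ∃ y, 1 ≤ y ∧ f₁ y = 0 := by
        by_contra! hne
        have h1 : 1 < blockCard (1 + (m + 1)) f₁ 0 := by omega
        rw [blockCard, Nat.count_eq_card_filter_range, Finset.one_lt_card] at h1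
        obtain ⟨x, hx, y, hy, hxy⟩ := h1
        have h2 := (Finset.mem_filter.1 hx).2
        have h3 := (Finset.mem_filter.1 hy).2
        have h4 := hne x
        have h5 := hne y
        omega
      have hex : ∃ y, 1 ≤ y ∧ f₁ y = 0 := ⟨y, hy, hy0⟩
      classical
      have h1 := Nat.find_spec hex
      have h2 : Nat.find hex < 1 + (m + 1) := by
        by_contra hge
        have := hF.planar_fst.eq_self _ (not_lt.1 hge)
        dsimp only at this
        omega
      refine ⟨Nat.find hex - 1, m + 1 - Nat.find hex, by omega, ?_, ?_⟩
      · rw [Nat.add_sub_cancel' h1.1]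
        exact h1.2
      · intro y hy hlt h
        exact Nat.find_min hex (m := y) (by omega) ⟨hy, h⟩
    have hsum : 1 + (a + b + 1) = 1 + a + (1 + b) := by ring
    rw [hsum] at hF
    have hp₁ : IsPlanarMap (1 + a + (1 + b)) f₁ := hF.planar_fst
    have hp₂ : IsPlanarMap (1 + a + (1 + b)) f₂ := hF.planar_snd
    have hr : Refines f₁ f₂ := hF.refines
    have h0' : f₂ (1 + a) = 0 := by rw [← hr, h0, hp₂.zero]
    have q₁ := hp₁.restrict (1 + a)
    have e₁ := attach_restrict_drop hp₁ (Or.inr h0)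
    have e₂ := attach_restrict_drop hp₂ (Or.inr h0')
    have hone : blockCard (1 + a) (restrict (1 + a) f₁) 0 = 1 := by
      rw [blockCard, Nat.count_eq_card_filter_range, Finset.card_eq_one]
      refine ⟨0, ?_⟩
      ext y
      have := hmin y
      have hz := q₁.zero
      simp only [Finset.mem_filter, Finset.mem_range, Finset.mem_singleton]
      constructor
      · rintro ⟨h1, h2⟩
        rw [restrict, if_pos h1] at h2
        omega
      · rintro rfl
        exact ⟨by omega, hz⟩
    have hzero := hF.blockCard_zero (by omega)
    dsimp only at hzero
    rw [← e₁, blockCard_attach_zero, hone] at hzero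
    refine ⟨a, b, rfl, (restrict (1 + a) f₁, restrict (1 + a) f₂),
      ⟨q₁, hp₂.restrict _, hr.restrict hp₁.le_self _, ?_⟩,
      (drop (1 + a) f₁, drop (1 + a) f₂), ⟨hp₁.drop, hp₂.drop, hr.drop hp₂.le_self _, ?_⟩, ?_⟩
    · intro v hv hfix
      dsimp only at *
      split_ifs with hv0
      · rw [hv0, hone]
      have := hF.blockCard_eq v (by omega) (by rwa [restrict, if_pos hv] at hfix)
      dsimp only at this
      rwa [← e₁, blockCard_attach_of_lt _ _ hv hv0, if_neg hv0] at this
    · intro v hv hfix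
      dsimp only at *
      split_ifs with hv0
      · rw [hv0]
        omega
      have := hF.blockCard_eq (1 + a + v) (by omega) (by
        simp only [drop] at hfix
        rw [add_comm v (1 + a)] at hfix
        dsimp only
        omega)
      dsimp only at this
      rwa [← e₁, blockCard_attach_add q₁ hv0, if_neg (by omega)] at this
    · dsimp only
      rw [e₁, e₂]

/-! ### The generating function -/

section GeneratingFunction

open PowerSeries

/-- The only partition of the empty set. -/
theorem ncard_doubles_zero (q j : ℕ) : (doubles q j 0).ncard = 1 := by
  rw [Set.ncard_eq_one]
  refine ⟨(id, id), Set.eq_singleton_iff_unique_mem.2 ⟨⟨IsPlanarMap.id 0, IsPlanarMap.id 0,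
    fun _ => rfl, fun v hv => absurd hv (Nat.not_lt_zero v)⟩, ?_⟩⟩
  rintro ⟨f₁, f₂⟩ hF
  ext x
  · exact hF.planar_fst.eq_self x (Nat.zero_le x)
  · exact hF.planar_snd.eq_self x (Nat.zero_le x)

/-- The generating function of double planar partitions with blocks of size `q` in the finer
partition. -/
noncomputable def doubleSeries (q : ℕ) : PowerSeries ℚ := mk fun m => ((doubles q q m).ncard : ℚ)

/-- The generating function of nonempty double planar partitions whose block of `0` in the finer
partition has `j` elements; the exponent does not count the element `0`. -/
noncomputable def rootedSeries (q j : ℕ) : PowerSeries ℚ :=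
  mk fun m => ((doubles q j (1 + m)).ncard : ℚ)

theorem rootedSeries_one (q : ℕ) : rootedSeries q 1 = doubleSeries q ^ 2 := by
  ext m
  simp only [rootedSeries, doubleSeries, sq, coeff_mul, coeff_mk, ncard_doubles_one]
  push_cast
  rfl

theorem rootedSeries_succ (q j : ℕ) (hj : 0 < j) :
    rootedSeries q (j + 1) = X * (rootedSeries q 1 * rootedSeries q j) := by
  ext m
  cases m with
  | zero =>
    -- a block with at least two elements does not fit into `{0}`
    have h : doubles q (j + 1) (1 + 0) = ∅ := by
      refine Set.eq_empty_of_forall_notMem fun F hF => ?_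
      have h1 := hF.blockCard_zero (by omega)
      have h2 : blockCard (1 + 0) F.1 0 ≤ 1 + 0 := Nat.count_le _
      omega
    simp [rootedSeries, h]
  | succ m =>
    rw [coeff_succ_X_mul]
    simp only [rootedSeries, coeff_mul, coeff_mk, ncard_doubles_succ q j m hj]
    push_cast
    rfl

theorem rootedSeries_eq (q j : ℕ) :
    rootedSeries q (j + 1) = X ^ j * doubleSeries q ^ (2 * (j + 1)) := by
  induction j with
  | zero => simp [rootedSeries_one]
  | succ j ih =>
    rw [rootedSeries_succ q (j + 1) (by omega), ih, rootedSeries_one]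
    ring

theorem doubleSeries_eq {q : ℕ} (hq : 0 < q) :
    doubleSeries q = 1 + X ^ q * doubleSeries q ^ (2 * q) := by
  obtain ⟨j, rfl⟩ : ∃ j, q = j + 1 := ⟨q - 1, by omega⟩
  have h : doubleSeries (j + 1) = 1 + X * rootedSeries (j + 1) (j + 1) := by
    ext m
    cases m with
    | zero => simp [doubleSeries, ncard_doubles_zero]
    | succ m =>
      rw [map_add, coeff_succ_X_mul, coeff_one, if_neg (by omega), zero_add]
      simp [doubleSeries, rootedSeries, add_comm]
  nth_rewrite 1 [h]
  rw [rootedSeries_eq]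
  ring

theorem ncard_doubles {q : ℕ} (hq : 0 < q) (n : ℕ) :
    ((doubles q q (q * n)).ncard : ℚ) = fussCatalan (2 * q) n := by
  rw [← raney_one, ← coeff_pow_eq_raney (by omega) hq (doubleSeries_eq hq), pow_one, doubleSeries,
    PowerSeries.coeff_mk]

end GeneratingFunction

/-! ### Partitions of `[m]` and their block minima -/

section BlockMin

variable {m : ℕ}

/-- The map sending `y` to the minimum of the block of `y`, where the ground set `[m]` is shifted
to `{0, …, m - 1}`, extended by the identity beyond `m`. -/
noncomputable def blockMin (P : Finpartition (interval m)) (y : ℕ) : ℕ :=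
  if y < m then sInf {k | k + 1 ∈ P.part (y + 1)} else y

theorem succ_mem_interval {y : ℕ} : y + 1 ∈ interval m ↔ y < m := by
  rw [interval, Finset.mem_Icc]
  omega

theorem exists_succ_of_mem_interval {x : ℕ} (hx : x ∈ interval m) : ∃ y < m, x = y + 1 := by
  have := Finset.mem_Icc.1 hx
  exact ⟨x - 1, by omega, by omega⟩

variable (P Q : Finpartition (interval m)) {x y k : ℕ}

theorem lt_of_mem_part (h : k + 1 ∈ P.part y) : k < m :=
  succ_mem_interval.1 (P.part_subset _ h)

theorem blockMin_of_le (hy : m ≤ y) : blockMin P y = y := if_neg (not_lt.2 hy)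

theorem blockMin_mem (hy : y < m) : blockMin P y + 1 ∈ P.part (y + 1) := by
  rw [blockMin, if_pos hy]
  exact Nat.sInf_mem (s := {k | k + 1 ∈ P.part (y + 1)})
    ⟨y, P.mem_part (succ_mem_interval.2 hy)⟩

theorem blockMin_le_of_mem (h : k + 1 ∈ P.part (y + 1)) : blockMin P y ≤ k := by
  have hy : y < m := by
    rw [← succ_mem_interval, ← P.part_nonempty]
    exact ⟨_, h⟩
  rw [blockMin, if_pos hy]
  exact Nat.sInf_le h

theorem blockMin_le_self (y : ℕ) : blockMin P y ≤ y := by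
  rcases lt_or_ge y m with hy | hy
  · exact blockMin_le_of_mem P (P.mem_part (succ_mem_interval.2 hy))
  · exact (blockMin_of_le P hy).le

theorem mem_part_iff (hy : y < m) :
    x + 1 ∈ P.part (y + 1) ↔ blockMin P x = blockMin P y := by
  rcases lt_or_ge x m with hx | hx
  · rw [P.mem_part_iff_part_eq_part (succ_mem_interval.2 hx) (succ_mem_interval.2 hy)]
    constructor
    · intro h
      rw [blockMin, blockMin, if_pos hx, if_pos hy, h]
    · intro h
      have h1 := P.part_eq_of_mem (P.part_mem.2 (succ_mem_interval.2 hx)) (blockMin_mem P hx)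
      have h2 := P.part_eq_of_mem (P.part_mem.2 (succ_mem_interval.2 hy)) (blockMin_mem P hy)
      rw [← h1, ← h2, h]
  · have h1 := blockMin_le_self P y
    rw [blockMin_of_le P hx]
    refine iff_of_false (fun h => ?_) (by omega)
    have := lt_of_mem_part P h
    omega

theorem blockMin_idem (y : ℕ) : blockMin P (blockMin P y) = blockMin P y := by
  rcases lt_or_ge y m with hy | hy
  · exact (mem_part_iff P hy).1 (blockMin_mem P hy)
  · rw [blockMin_of_le P hy, blockMin_of_le P hy]

theorem exists_eq_part {B : Finset ℕ} (hB : B ∈ P.parts) : ∃ y < m, B = P.part (y + 1) := by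
  obtain ⟨x, hx⟩ := P.nonempty_of_mem_parts hB
  obtain ⟨y, hy, rfl⟩ := exists_succ_of_mem_interval (P.le hB hx)
  exact ⟨y, hy, (P.part_eq_of_mem hB hx).symm⟩

theorem part_succ_mem (hy : y < m) : P.part (y + 1) ∈ P.parts :=
  P.part_mem.2 (succ_mem_interval.2 hy)

theorem blockMin_injective : Function.Injective (blockMin (m := m)) := by
  intro P Q h
  have hpart : ∀ y < m, P.part (y + 1) = Q.part (y + 1) := by
    intro y hy
    ext x
    constructor <;> intro hx
    · obtain ⟨z, _, rfl⟩ := exists_succ_of_mem_interval (P.part_subset _ hx)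
      rwa [mem_part_iff _ hy, h, ← mem_part_iff _ hy] at hx
    · obtain ⟨z, _, rfl⟩ := exists_succ_of_mem_interval (Q.part_subset _ hx)
      rwa [mem_part_iff _ hy, ← h, ← mem_part_iff _ hy] at hx
  ext B
  constructor <;> intro hB
  · obtain ⟨y, hy, rfl⟩ := exists_eq_part P hB
    rw [hpart y hy]
    exact part_succ_mem Q hy
  · obtain ⟨y, hy, rfl⟩ := exists_eq_part Q hB
    rw [← hpart y hy]
    exact part_succ_mem P hy

theorem exists_blockMin_eq {f : ℕ → ℕ} (hf : IsPlanarMap m f) :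
    ∃ P : Finpartition (interval m), blockMin P = f := by
  classical
  let s : Setoid ℕ := Setoid.ker fun x => f (x - 1)
  let P := Finpartition.ofSetSetoid s (interval m)
  refine ⟨P, ?_⟩
  ext y
  rcases lt_or_ge y m with hy | hy
  · have hmem : ∀ k, k + 1 ∈ P.part (y + 1) ↔ k < m ∧ f y = f k := by
      intro k
      rw [Finpartition.mem_part_ofSetSetoid_iff_rel, succ_mem_interval, succ_mem_interval]
      change _ ∧ _ ∧ f (y + 1 - 1) = f (k + 1 - 1) ↔ _
      simp [hy]
    apply le_antisymm
    · exact blockMin_le_of_mem P ((hmem _).2 ⟨(hf.le_self y).trans_lt hy, (hf.idem y).symm⟩)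
    · rw [((hmem _).1 (blockMin_mem P hy)).2]
      exact hf.le_self _
  · rw [blockMin_of_le P hy, hf.eq_self y hy]

/-- Two crossing blocks produce crossing arcs: if `u < v < x < y` with `u`, `x` in one block and
`v`, `y` in another one, then the arc of the first block passing over `v` crosses the arc of the
second block passing over the right end of the former. -/
theorem isPlanar_iff : IsPlanar P ↔ IsPlanarMap m (blockMin P) := by
  constructor
  · intro h
    refine ⟨blockMin_le_self P, ?_, fun x => blockMin_of_le P⟩
    intro x y hyx hxy
    rcases lt_or_ge y m with hy | hy
    swap
    · rw [blockMin_of_le P hy] at hyx ⊢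
      obtain rfl : x = y := by omega
      rw [blockMin_of_le P hy]
    by_contra! hlt
    have hx : x < m := by omega
    have hyx' : blockMin P y ≠ x := by
      rintro rfl
      rw [blockMin_idem] at hlt
      omega
    have hxy' : x ≠ y := by
      rintro rfl
      omega
    set B := P.part (x + 1) with hB
    set C := P.part (y + 1) with hC
    set v := blockMin P y + 1 with hv
    have hdisj : ∀ z, z ∈ B → z ∉ C := by
      intro z hzB hzC
      obtain ⟨w, -, rfl⟩ := exists_succ_of_mem_interval (P.part_subset _ hzB)
      have h1 := (mem_part_iff P hx).1 hzB
      have h2 := (mem_part_iff P hy).1 hzC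
      omega
    have hvC : v ∈ C := blockMin_mem P hy
    have hyC : y + 1 ∈ C := P.mem_part (succ_mem_interval.2 hy)
    have hxB : x + 1 ∈ B := P.mem_part (succ_mem_interval.2 hx)
    have huB : blockMin P x + 1 ∈ B := blockMin_mem P hx
    have hvB : v ∉ B := fun h => hdisj v h hvC
    obtain ⟨i, hi, hi'⟩ := exists_max_image {z ∈ B | z < v} id
      ⟨_, mem_filter.2 ⟨huB, by omega⟩⟩
    obtain ⟨j, hj, hj'⟩ := exists_min_image {z ∈ B | v < z} id
      ⟨_, mem_filter.2 ⟨hxB, by omega⟩⟩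
    rw [mem_filter] at hi hj
    have hjC := hdisj j hj.1
    have hjx : j ≤ x + 1 := hj' _ (mem_filter.2 ⟨hxB, by omega⟩)
    obtain ⟨k, hk, hk'⟩ := exists_max_image {z ∈ C | z < j} id
      ⟨_, mem_filter.2 ⟨hvC, hj.2⟩⟩
    obtain ⟨l, hl, hl'⟩ := exists_min_image {z ∈ C | j < z} id
      ⟨_, mem_filter.2 ⟨hyC, by omega⟩⟩
    rw [mem_filter] at hk hl
    have hvk : v ≤ k := hk' _ (mem_filter.2 ⟨hvC, hj.2⟩)
    refine h i j k l ⟨by omega, B, part_succ_mem P hx, hi.1, hj.1, ?_⟩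
      ⟨by omega, C, part_succ_mem P hy, hk.1, hl.1, ?_⟩ ⟨by omega, hk.2, hl.2⟩
    · rintro z hz ⟨hiz, hzj⟩
      rcases lt_trichotomy z v with hzv | rfl | hzv
      · have := hi' z (mem_filter.2 ⟨hz, hzv⟩)
        simp only [id] at this
        omega
      · exact hvB hz
      · have := hj' z (mem_filter.2 ⟨hz, hzv⟩)
        simp only [id] at this
        omega
    · rintro z hz ⟨hkz, hzl⟩
      rcases lt_trichotomy z j with hzv | rfl | hzv
      · have := hk' z (mem_filter.2 ⟨hz, hzv⟩)
        simp only [id] at this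
        omega
      · exact hjC hz
      · have := hl' z (mem_filter.2 ⟨hz, hzv⟩)
        simp only [id] at this
        omega
  · rintro hf i j k l ⟨-, B, hB, hi, hj, hcons⟩ ⟨-, C, hC, hk, hl, -⟩ ⟨hik, hkj, hjl⟩
    obtain ⟨i, him, rfl⟩ := exists_succ_of_mem_interval (P.le hB hi)
    obtain ⟨j, hjm, rfl⟩ := exists_succ_of_mem_interval (P.le hB hj)
    obtain ⟨k, hkm, rfl⟩ := exists_succ_of_mem_interval (P.le hC hk)
    obtain ⟨l, hlm, rfl⟩ := exists_succ_of_mem_interval (P.le hC hl)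
    obtain rfl := P.part_eq_of_mem hB hi
    obtain rfl := P.part_eq_of_mem hC hk
    have h1 := (mem_part_iff P him).1 hj
    have h2 := (mem_part_iff P hkm).1 hl
    have h3 := hf.le_self i
    have h4 := hf.le_self k
    have h5 := hf.le_of_le k j
    have h6 := hf.le_of_le j l
    have h7 : blockMin P k = blockMin P i := by omega
    exact hcons (k + 1) ((mem_part_iff P him).2 h7) ⟨hik, hkj⟩

theorem isRefinement_iff : IsRefinement P Q ↔ Refines (blockMin P) (blockMin Q) := by
  constructor
  · intro h y
    rcases lt_or_ge y m with hy | hy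
    · obtain ⟨C, hC, hsub⟩ := h _ (part_succ_mem P hy)
      obtain rfl := Q.part_eq_of_mem hC (hsub (P.mem_part (succ_mem_interval.2 hy)))
      exact (mem_part_iff Q hy).1 (hsub (blockMin_mem P hy))
    · rw [blockMin_of_le P hy]
  · intro h B hB
    obtain ⟨y, hy, rfl⟩ := exists_eq_part P hB
    refine ⟨_, part_succ_mem Q hy, fun x hx => ?_⟩
    obtain ⟨z, -, rfl⟩ := exists_succ_of_mem_interval (P.part_subset _ hx)
    rw [mem_part_iff P hy] at hx
    rw [mem_part_iff Q hy, ← h z, hx, h y]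

theorem card_part (hy : y < m) :
    #(P.part (y + 1)) = blockCard m (blockMin P) (blockMin P y) := by
  rw [blockCard, Nat.count_eq_card_filter_range]
  symm
  refine Finset.card_bij (fun x _ => x + 1) ?_ (fun _ _ _ _ h => Nat.succ_injective h) ?_
  · intro x hx
    exact (mem_part_iff P hy).2 (Finset.mem_filter.1 hx).2
  · intro x hx
    obtain ⟨z, hz, rfl⟩ := exists_succ_of_mem_interval (P.part_subset _ hx)
    exact ⟨z, Finset.mem_filter.2 ⟨Finset.mem_range.2 hz, (mem_part_iff P hy).1 hx⟩, rfl⟩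

theorem isQPartition_iff (q : ℕ) :
    IsQPartition q P ↔ ∀ v < m, blockMin P v = v → blockCard m (blockMin P) v = q := by
  constructor
  · intro h v hv hfix
    rw [← h _ (part_succ_mem P hv), card_part P hv, hfix]
  · intro h B hB
    obtain ⟨y, hy, rfl⟩ := exists_eq_part P hB
    rw [card_part P hy, h _ ((blockMin_le_self P y).trans_lt hy) (blockMin_idem P y)]

theorem image_blockMin (q m : ℕ) :
    Prod.map blockMin blockMin '' {D ∈ doublePlanarPartitions m | IsQPartition q D.1} =
      doubles q q m := by
  ext ⟨f₁, f₂⟩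
  constructor
  · rintro ⟨⟨P, Q⟩, ⟨⟨h1, h2, h3⟩, h4⟩, h⟩
    obtain ⟨rfl, rfl⟩ := Prod.mk.inj h
    refine ⟨(isPlanar_iff P).1 h1, (isPlanar_iff Q).1 h2, (isRefinement_iff P Q).1 h3, ?_⟩
    intro v hv hfix
    rw [ite_self]
    exact (isQPartition_iff P q).1 h4 v hv hfix
  · rintro ⟨h1, h2, h3, h4⟩
    obtain ⟨P, rfl⟩ := exists_blockMin_eq h1
    obtain ⟨Q, rfl⟩ := exists_blockMin_eq h2
    refine ⟨(P, Q), ⟨⟨(isPlanar_iff P).2 h1, (isPlanar_iff Q).2 h2, (isRefinement_iff P Q).2 h3⟩,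
      (isQPartition_iff P q).2 fun v hv hfix => ?_⟩, rfl⟩
    simpa using h4 v hv hfix

end BlockMin

end FussCatalan

theorem theorem2 (p q n : ℕ) (hq : 0 < q) (hp : p = 2 * q) :
    (({D ∈ FussCatalan.doublePlanarPartitions (q * n) |
        FussCatalan.IsQPartition q D.1}.ncard : ℕ) : ℚ) = FussCatalan.fussCatalan p n := by
  rw [hp, ← FussCatalan.ncard_doubles hq, ← FussCatalan.image_blockMin,
    Set.ncard_image_of_injective _
      (FussCatalan.blockMin_injective.prodMap FussCatalan.blockMin_injective)]
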